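/- Let $0<T\le\infty$, let $\Delta=(0,T]$ (with $\Delta=(0,\infty)$ if $T=\infty$) and $x+\Delta=(x,x+T]$; write $g(x)\sim h(x)$ if $g(x)/h(x)\to1$ as $x\to\infty$. A probability distribution $F$ on $\mathbb R$ belongs to $\mathcal L_\Delta$ if $F(x+\Delta)>0$ for all sufficiently large $x$ and $F(x+t+\Delta)/F(x+\Delta)\to1$ as $x\to\infty$, uniformly in $t\in[0,1]$. A distribution $F$ on $[0,\infty)$ with unbounded support belongs to $\mathcal S_\Delta$ if $F\in\mathcal L_\Delta$ and $(F*F)(x+\Delta)\sim 2F(x+\Delta)$. Consider a Bellman–Harris (age-dependent) branching process started at time $0$ from one particle of age zero: each particle lives for a random time with law $F$ on $[0,\infty)$ and at its death is replaced by a random number of new particles with a fixed offspring law on $\{0,1,2,\dots\}$, all lifetimes and offspring numbers being independent. Suppose that the mean $A$ of the offspring law satisfies $0<A<1$. Let $Z(t)$ be the number of particles alive at time $t$ and $A(t)=\mathbf E Z(t)$, with $A(\infty)=0$. If $F\in\mathcal L_\Delta$, then $A(t)<\infty$ for all $t$, and the following are equivalent: (i) $F\in\mathcal S_\Delta$; (ii)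 $A(t)-A(t+T)\sim F(t+\Delta)/(1-A)$ as $t\to\infty$. -/

import Mathlib

open MeasureTheory ProbabilityTheory Filter Topology Set
open scoped ENNReal

/-- The translate `x + Δ = (x, x + T]` of `Δ = (0, T]`; for `T = ⊤` it is `(x, ∞)`. -/
def shiftedDelta (T : EReal) (x : ℝ) : Set ℝ :=
  {y : ℝ | x < y ∧ (y : EReal) ≤ (x : EReal) + T}

/-- The class `L_Δ`, for distributions `F` on the real line. -/
structure DeltaLongTailed (T : EReal) (F : Measure ℝ) : Prop where
  eventually_pos : ∀ᶠ x : ℝ in atTop, 0 < F.real (shiftedDelta T x)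
  tendsto : TendstoUniformlyOn
    (fun x t : ℝ => F.real (shiftedDelta T (x + t)) / F.real (shiftedDelta T x))
    (fun _ => 1) atTop (Icc (0 : ℝ) 1)

/-- The class `S_Δ` of `Δ`-subexponential distributions. -/
structure DeltaSubexponential (T : EReal) (F : Measure ℝ) : Prop where
  nonneg : F (Iio 0) = 0
  unbounded_support : ∀ x : ℝ, 0 < F (Ioi x)
  longTailed : DeltaLongTailed T F
  conv_tendsto : Tendsto
    (fun x : ℝ => (Measure.conv F F).real (shiftedDelta T x) / (2 * F.real (shiftedDelta T x)))
    atTop (𝓝 1)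

/-- The mean `∑ k * p k` of an offspring law `p`. -/
noncomputable def offspringMean (p : PMF ℕ) : ℝ≥0∞ := ∑' k : ℕ, (k : ℝ≥0∞) * p k

/-- Potential particles are labelled by lists: `[]` is the initial particle and `i :: u` is the
`i`-th child (`i = 0, 1, …`) of `u`. Given the numbers of children `N`, this says that the
particle is ever born. -/
def everBorn (N : List ℕ → ℕ) : List ℕ → Prop
  | [] => True
  | i :: u => everBorn N u ∧ i < N u

/-- The birth time of a particle, given the lifetimes `L`: children are born when their parent
dies, and the initial particle is born at time `0`. -/
def birthTime (L : List ℕ → ℝ) : List ℕ → ℝ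
  | [] => 0
  | _ :: u => birthTime L u + L u

/-- The particles alive at time `s`. The time may be infinite; no particle is alive at `s = ⊤`. -/
def aliveAt (L : List ℕ → ℝ) (N : List ℕ → ℕ) (s : EReal) : Set (List ℕ) :=
  {u | everBorn N u ∧ (birthTime L u : EReal) ≤ s ∧ s < ((birthTime L u + L u : ℝ) : EReal)}

/-- `L u ω` and `N u ω`, the lifetime and the number of children of the particle `u`, drive a
Bellman–Harris process with lifetime law `F` and offspring law `p` that starts from one particle
of age zero: all lifetimes and numbers of children are independent, with these laws. -/
structure IsBellmanHarris {Ω : Type*} [MeasurableSpace Ω] (P : Measure Ω)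
    (F : Measure ℝ) (p : PMF ℕ) (L : List ℕ → Ω → ℝ) (N : List ℕ → Ω → ℕ) : Prop where
  hasLaw : ∀ u : List ℕ, HasLaw (fun ω => (L u ω, N u ω)) (F.prod p.toMeasure) P
  indep : iIndepFun (fun (u : List ℕ) ω => (L u ω, N u ω)) P

/-- The population size `Z(s)`. -/
noncomputable def population {Ω : Type*} (L : List ℕ → Ω → ℝ) (N : List ℕ → Ω → ℕ)
    (s : EReal) (ω : Ω) : ℝ≥0∞ :=
  ((aliveAt (fun u => L u ω) (fun u => N u ω) s).encard : ℝ≥0∞)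

/-- The mean population size `A(s) = E Z(s)`. -/
noncomputable def meanPopulation {Ω : Type*} [MeasurableSpace Ω] (P : Measure Ω)
    (L : List ℕ → Ω → ℝ) (N : List ℕ → Ω → ℕ) (s : EReal) : ℝ≥0∞ :=
  ∫⁻ ω, population L N s ω ∂P

/-! The mean population is the tail of a compound geometric law, and the theorem is a statement
about the renewal equation of that law.

Let `m` be the mean number of children. A particle is born at the death of its parent, and its
lifetime and its number of children are independent of its birth. Summing over all particles, the
expected number `M` of births in a set of times satisfies `M = δ₀ + m M ∗ F`, where `M ∗ F` counts
the deaths, and `M` has total mass `1 / (1 - m)` (the `n`-th generation contributes `m ^ n`). The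
particles alive at time `t` are those born by `t` and not dead by `t`, so the mean population is
`M (-∞, t] - (M ∗ F) (-∞, t]`. For `t ≥ 0` this is the tail `G (t, ∞)` of the probability law
`G = (1 - m) M ∗ F`, which satisfies `G = (1 - m) F + m F ∗ G` (`IsBellmanHarris.exists_renewal`).
The increment in the theorem is therefore `G (t + Δ)`. No more than the renewal equation is needed
about `G`; the series of convolution powers does not appear.

Since `F` is `Δ`-long-tailed, `μ ∗ ν` has at least the asymptotic mass on `x + Δ` that comes from
one bounded summand and one that jumps (`AsymptoticallyGE.conv`): if `μ (x + Δ)` and `ν (x + Δ)`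
are asymptotically at least `a` and `b` times `F (x + Δ)`, then for `μ ∗ ν` the constant is `a + b`
(for probability laws). Iterating the renewal equation, `a ↦ (1 - m) + m (1 + a)`, gives the lower
bound `1 / (1 - m)` for `G` whether or not `F` is subexponential.

If `F` is `Δ`-subexponential, two large summands are negligible for `F ∗ F`, hence also for `F ∗ G`
once `G (x + Δ) = O(F (x + Δ))` is known. The latter is a Kesten-type bound that also follows from
the renewal equation (`exists_forall_le_mul`). So the upper constants obey the same recursion, and
they decrease to `1 / (1 - m)`.

Conversely, if `G (x + Δ) ∼ F (x + Δ) / (1 - m)`, the renewal equation gives the asymptotics of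
`F ∗ G`. In `F ∗ G = (1 - m) F ∗ F + m F ∗ (F ∗ G)` the lower bound for the last term leaves no more
than `2 F (x + Δ)` for `F ∗ F` (`asymptoticallyLE_conv_self_of_renewal`), and the lower bound for
`F ∗ F` holds always.
-/

/-! ### Translates of `Δ` and the joint mass -/

lemma shiftedDelta_top (x : ℝ) : shiftedDelta ⊤ x = Ioi x := by
  ext y; simp [shiftedDelta]

lemma shiftedDelta_coe (r x : ℝ) : shiftedDelta (r : EReal) x = Ioc x (x + r) := by
  ext y
  simp only [shiftedDelta, mem_ofPred_eq, mem_Ioc, ← EReal.coe_add, EReal.coe_le_coe_iff]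

lemma measurableSet_shiftedDelta (T : EReal) (x : ℝ) : MeasurableSet (shiftedDelta T x) := by
  induction T with
  | bot => simp [shiftedDelta]
  | top => rw [shiftedDelta_top]; exact measurableSet_Ioi
  | coe r => rw [shiftedDelta_coe]; exact measurableSet_Ioc

lemma add_mem_shiftedDelta_iff {T : EReal} {x y z : ℝ} :
    y + z ∈ shiftedDelta T x ↔ z ∈ shiftedDelta T (x - y) := by
  induction T with
  | bot => simp [shiftedDelta]
  | top => simp only [shiftedDelta_top, mem_Ioi]; constructor <;> intro h <;> linarith
  | coe r =>
    simp only [shiftedDelta_coe, mem_Ioc]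
    constructor <;> rintro ⟨h, h'⟩ <;> constructor <;> linarith

lemma lt_of_mem_shiftedDelta {T : EReal} {x y : ℝ} (h : y ∈ shiftedDelta T x) : x < y := h.1

/-- If `y + z` lies in `x + Δ` with `y > x - h` and `z ≥ h`, then `y` lies in `x - h + Δ`: on the
right, the translate is exceeded by no more than the part of `z` beyond `h`. -/
lemma mem_shiftedDelta_sub {T : EReal} {x y z h : ℝ} (hs : y + z ∈ shiftedDelta T x)
    (hy : x - h < y) (hz : h ≤ z) : y ∈ shiftedDelta T (x - h) := by
  induction T with
  | bot => simp [shiftedDelta] at hs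
  | top => simpa [shiftedDelta_top] using hy
  | coe r =>
    simp only [shiftedDelta_coe, mem_Ioc] at hs ⊢
    exact ⟨hy, by linarith [hs.2]⟩

/-- The mass that `X ∈ E`, `X + Y ∈ x + Δ` receives when `X` and `Y` are independent with
laws `μ` and `ν`. -/
noncomputable def jointMass (T : EReal) (μ ν : Measure ℝ) (E : Set ℝ) (x : ℝ) : ℝ :=
  (μ.prod ν).real {p | p.1 ∈ E ∧ p.1 + p.2 ∈ shiftedDelta T x}

lemma measurableSet_jointMass (T : EReal) {E : Set ℝ} (hE : MeasurableSet E) (x : ℝ) :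
    MeasurableSet {p : ℝ × ℝ | p.1 ∈ E ∧ p.1 + p.2 ∈ shiftedDelta T x} :=
  (measurable_fst hE).inter ((measurable_fst.add measurable_snd) (measurableSet_shiftedDelta T x))

lemma jointMass_nonneg (T : EReal) (μ ν : Measure ℝ) (E : Set ℝ) (x : ℝ) :
    0 ≤ jointMass T μ ν E x := measureReal_nonneg

lemma conv_real_shiftedDelta (T : EReal) (μ ν : Measure ℝ) (x : ℝ) :
    (μ.conv ν).real (shiftedDelta T x) = (μ.prod ν).real {p | p.1 + p.2 ∈ shiftedDelta T x} := by
  unfold Measure.real Measure.conv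
  rw [Measure.map_apply (by fun_prop) (measurableSet_shiftedDelta T x)]
  rfl

lemma measurable_measureReal_shiftedDelta (T : EReal) (ν : Measure ℝ) [IsFiniteMeasure ν] (x : ℝ) :
    Measurable fun y : ℝ => ν.real (shiftedDelta T (x - y)) := by
  have h := measurable_measure_prodMk_left (ν := ν) (measurableSet_jointMass T MeasurableSet.univ x)
  simpa [preimage, add_mem_shiftedDelta_iff, Measure.real] using h.ennreal_toReal

lemma integrable_measureReal_shiftedDelta (T : EReal) (μ ν : Measure ℝ) [IsFiniteMeasure μ]
    [IsFiniteMeasure ν] (x : ℝ) :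
    Integrable (fun y : ℝ => ν.real (shiftedDelta T (x - y))) μ := by
  refine Integrable.of_bound (measurable_measureReal_shiftedDelta T ν x).aestronglyMeasurable
    (ν.real univ) (ae_of_all _ fun y => ?_)
  rw [Real.norm_of_nonneg measureReal_nonneg]
  exact measureReal_mono (subset_univ _)

lemma jointMass_eq_setIntegral (T : EReal) (μ ν : Measure ℝ) [IsFiniteMeasure μ]
    [IsFiniteMeasure ν] {E : Set ℝ} (hE : MeasurableSet E) (x : ℝ) :
    jointMass T μ ν E x = ∫ y in E, ν.real (shiftedDelta T (x - y)) ∂μ := by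
  unfold jointMass Measure.real
  rw [Measure.prod_apply (measurableSet_jointMass T hE x), integral_toReal]
  · rw [← lintegral_indicator hE]
    congr 1
    refine lintegral_congr fun y => ?_
    by_cases hy : y ∈ E <;> simp [hy, preimage, add_mem_shiftedDelta_iff]
  · have h := measurable_measure_prodMk_left (ν := ν)
      (measurableSet_jointMass T MeasurableSet.univ x)
    simp only [preimage, mem_univ, true_and, add_mem_shiftedDelta_iff, mem_ofPred_eq,
      ofPred_mem_eq] at h
    exact h.aemeasurable
  · exact ae_of_all _ fun y => measure_lt_top _ _

section
variable {T : EReal} {μ ν ν' : Measure ℝ} [IsFiniteMeasure μ] [IsFiniteMeasure ν]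
  [IsFiniteMeasure ν'] {E : Set ℝ} {x c : ℝ}

lemma jointMass_le_mul_jointMass (hE : MeasurableSet E)
    (h : ∀ y ∈ E, ν.real (shiftedDelta T (x - y)) ≤ c * ν'.real (shiftedDelta T (x - y))) :
    jointMass T μ ν E x ≤ c * jointMass T μ ν' E x := by
  rw [jointMass_eq_setIntegral T μ ν hE, jointMass_eq_setIntegral T μ ν' hE, ← integral_const_mul]
  exact setIntegral_mono_on (integrable_measureReal_shiftedDelta T μ ν x).integrableOn
    ((integrable_measureReal_shiftedDelta T μ ν' x).integrableOn.const_mul c) hE h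

lemma jointMass_le (hE : MeasurableSet E)
    (h : ∀ y ∈ E, ν.real (shiftedDelta T (x - y)) ≤ c) :
    jointMass T μ ν E x ≤ c * μ.real E := by
  rw [jointMass_eq_setIntegral T μ ν hE]
  refine (setIntegral_mono_on (integrable_measureReal_shiftedDelta T μ ν x).integrableOn
    (integrable_const c).integrableOn hE h).trans ?_
  simp [mul_comm]

lemma le_jointMass (hE : MeasurableSet E)
    (h : ∀ y ∈ E, c ≤ ν.real (shiftedDelta T (x - y))) :
    c * μ.real E ≤ jointMass T μ ν E x := by
  rw [jointMass_eq_setIntegral T μ ν hE]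
  refine le_trans ?_ (setIntegral_mono_on (integrable_const c).integrableOn
    (integrable_measureReal_shiftedDelta T μ ν x).integrableOn hE h)
  simp [mul_comm]

/-- The mass of the event that the second coordinate lies in `E`, by exchanging coordinates. -/
lemma prod_real_snd_mem (E : Set ℝ) (hE : MeasurableSet E) (x : ℝ) :
    (μ.prod ν).real {p | p.2 ∈ E ∧ p.1 + p.2 ∈ shiftedDelta T x} = jointMass T ν μ E x := by
  unfold jointMass Measure.real
  rw [← Measure.prod_swap, Measure.map_apply measurable_swap]
  · simp [preimage, add_comm]
  · exact (measurable_snd hE).inter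
      ((measurable_fst.add measurable_snd) (measurableSet_shiftedDelta T x))

/-- Three disjoint ways to reach `x + Δ`: a first summand of at most `h`, a second summand of at
most `h`, or a first summand between `h` and `x - h`, which makes both summands exceed `h`. -/
lemma jointMass_add_le_conv {h : ℝ} (hx : 2 * h < x) :
    jointMass T μ ν (Icc 0 h) x + jointMass T ν μ (Icc 0 h) x + jointMass T μ ν (Ioc h (x - h)) x
      ≤ (μ.conv ν).real (shiftedDelta T x) := by
  rw [conv_real_shiftedDelta, ← prod_real_snd_mem (μ := μ) (ν := ν) _ measurableSet_Icc]
  unfold jointMass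
  have hm : MeasurableSet {p : ℝ × ℝ | p.2 ∈ Icc 0 h ∧ p.1 + p.2 ∈ shiftedDelta T x} :=
    (measurable_snd measurableSet_Icc).inter
      ((measurable_fst.add measurable_snd) (measurableSet_shiftedDelta T x))
  rw [← measureReal_union _ hm, ← measureReal_union _ (measurableSet_jointMass T measurableSet_Ioc x)]
  · refine measureReal_mono ?_
    rintro p ((hp | hp) | hp) <;> exact hp.2
  · rw [Set.disjoint_left]
    rintro p (hp | hp) hq
    · exact absurd hp.1.2 (not_le.2 hq.1.1)
    · linarith [hp.1.2, hq.1.2, lt_of_mem_shiftedDelta hq.2]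
  · rw [Set.disjoint_left]
    rintro p hp hq
    linarith [hp.1.2, hq.1.2, lt_of_mem_shiftedDelta hq.2]

/-- If the second summand is at most `h` and the sum exceeds `x`, then the first one exceeds
`x - h`, so that it is not at most `z`. -/
lemma jointMass_Icc_add_le_conv {h z : ℝ} (hz : z ≤ x - h) :
    jointMass T μ ν (Icc 0 z) x + jointMass T ν μ (Icc 0 h) x
      ≤ (μ.conv ν).real (shiftedDelta T x) := by
  rw [conv_real_shiftedDelta, ← prod_real_snd_mem (μ := μ) (ν := ν) _ measurableSet_Icc]
  unfold jointMass
  have hm : MeasurableSet {p : ℝ × ℝ | p.2 ∈ Icc 0 h ∧ p.1 + p.2 ∈ shiftedDelta T x} :=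
    (measurable_snd measurableSet_Icc).inter
      ((measurable_fst.add measurable_snd) (measurableSet_shiftedDelta T x))
  rw [← measureReal_union _ hm]
  · refine measureReal_mono ?_
    rintro p (hp | hp) <;> exact hp.2
  · rw [Set.disjoint_left]
    rintro p hp hq
    linarith [hp.1.2, hq.1.2, lt_of_mem_shiftedDelta hq.2]

lemma prod_real_union_ae_le {A B C : Set (ℝ × ℝ)} (hν : ν (Iio 0) = 0) (hμ : μ (Iio 0) = 0)
    (h : ∀ p : ℝ × ℝ, 0 ≤ p.1 → 0 ≤ p.2 → p ∈ A → p ∈ B ∪ C) :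
    (μ.prod ν).real A ≤ (μ.prod ν).real B + (μ.prod ν).real C := by
  refine le_trans ?_ (measureReal_union_le B C)
  refine ENNReal.toReal_mono (measure_ne_top _ _) (measure_mono_ae ?_)
  have h1 : ∀ᵐ p ∂(μ.prod ν), 0 ≤ p.1 := by
    have : ∀ᵐ y ∂μ, 0 ≤ y := by
      rw [ae_iff]; simpa [Iio] using hμ
    exact Measure.quasiMeasurePreserving_fst.ae this
  have h2 : ∀ᵐ p ∂(μ.prod ν), 0 ≤ p.2 := by
    have : ∀ᵐ y ∂ν, 0 ≤ y := by
      rw [ae_iff]; simpa [Iio] using hν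
    exact Measure.quasiMeasurePreserving_snd.ae this
  filter_upwards [h1, h2] with p a b c using h p a b c

/-- Of two nonnegative summands the first is at most `z`, or it is larger than `z`. -/
lemma conv_le_jointMass_add (hμ : μ (Iio 0) = 0) (hν : ν (Iio 0) = 0) (z x : ℝ) :
    (μ.conv ν).real (shiftedDelta T x)
      ≤ jointMass T μ ν (Icc 0 z) x + jointMass T μ ν (Ioi z) x := by
  rw [conv_real_shiftedDelta]
  refine prod_real_union_ae_le hν hμ fun p h1 h2 hp => ?_
  rcases le_or_gt p.1 z with h | h
  · exact Or.inl ⟨⟨h1, h⟩, hp⟩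
  · exact Or.inr ⟨h, hp⟩

lemma jointMass_Icc_le_add (h z x : ℝ) :
    jointMass T μ ν (Icc 0 z) x ≤ jointMass T μ ν (Icc 0 h) x + jointMass T μ ν (Ioc h z) x := by
  refine le_trans (measureReal_mono ?_) (measureReal_union_le _ _)
  rintro p ⟨hp, hq⟩
  rcases le_or_gt p.1 h with h' | h'
  · exact Or.inl ⟨⟨hp.1, h'⟩, hq⟩
  · exact Or.inr ⟨⟨h', hp.2⟩, hq⟩

/-- A large first summand: either the second one is at most `h`, or the first one lies in
`x - h + Δ` and the second one, independently, exceeds `h`. -/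
lemma jointMass_Ioi_le (hμ : μ (Iio 0) = 0) (hν : ν (Iio 0) = 0) (h x : ℝ) :
    jointMass T μ ν (Ioi (x - h)) x
      ≤ jointMass T ν μ (Icc 0 h) x + μ.real (shiftedDelta T (x - h)) * ν.real (Ioi h) := by
  rw [← prod_real_snd_mem _ measurableSet_Icc, ← measureReal_prod_prod]
  refine prod_real_union_ae_le hν hμ fun p h1 h2 hp => ?_
  rcases le_or_gt p.2 h with h' | h'
  · exact Or.inl ⟨⟨h2, h'⟩, hp.2⟩
  · exact Or.inr ⟨mem_shiftedDelta_sub hp.2 hp.1 h'.le, h'⟩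

end

/-! ### Long-tailedness and asymptotic bounds -/

namespace DeltaLongTailed

variable {T : EReal} {F : Measure ℝ}

/-- The uniform convergence on `[0, 1]` extends to all bounded shifts. -/
lemma eventually_abs_sub_le (hL : DeltaLongTailed T F) (K : ℝ) {η : ℝ} (hη : 0 < η) :
    ∀ᶠ x : ℝ in atTop, ∀ s ∈ Icc (0 : ℝ) K,
      |F.real (shiftedDelta T (x - s)) - F.real (shiftedDelta T x)|
        ≤ η * F.real (shiftedDelta T x) := by
  -- A multiplicative form of the claim is stable under composing shifts.
  have key : ∀ n : ℕ, ∀ c : ℝ, 1 < c → ∀ᶠ x : ℝ in atTop, ∀ s ∈ Icc (0 : ℝ) n,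
      F.real (shiftedDelta T (x - s)) ≤ c * F.real (shiftedDelta T x) ∧
      F.real (shiftedDelta T x) ≤ c * F.real (shiftedDelta T (x - s)) := by
    intro n
    induction n with
    | zero =>
      intro c hc
      refine Eventually.of_forall fun x s hs => ?_
      obtain rfl : s = 0 := le_antisymm (by simpa using hs.2) hs.1
      have := measureReal_nonneg (μ := F) (s := shiftedDelta T x)
      simp only [sub_zero]
      constructor <;> nlinarith
    | succ n ih =>
      intro c hc
      set d := √c with hd
      have hd1 : 1 < d := by rw [hd]; exact Real.lt_sqrt_of_sq_lt (by simpa using hc)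
      have hdd : d * d = c := Real.mul_self_sqrt (by linarith)
      have hd0 : 0 < d := by linarith
      have h1 := (Metric.tendstoUniformlyOn_iff.1 hL.tendsto (1 - d⁻¹)
        (by have := inv_lt_one_of_one_lt₀ hd1; linarith)).and hL.eventually_pos
      obtain ⟨X₁, hX₁⟩ := eventually_atTop.1 h1
      obtain ⟨X₂, hX₂⟩ := eventually_atTop.1 (ih d hd1)
      filter_upwards [eventually_ge_atTop (X₁ + 1), eventually_ge_atTop (X₂ + 1)]
        with x hx₁ hx₂ s hs
      push_cast at hs
      have ht : min s 1 ∈ Icc (0 : ℝ) 1 := ⟨le_min hs.1 zero_le_one, min_le_right _ _⟩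
      have hs' : s - min s 1 ∈ Icc (0 : ℝ) n := by
        refine ⟨by linarith [min_le_left s 1], ?_⟩
        rcases min_choice s 1 with h | h <;> rw [h]
        · simp
        · linarith [hs.2]
      have h2 := hX₂ (x - min s 1) (by linarith [ht.2]) _ hs'
      rw [show x - min s 1 - (s - min s 1) = x - s by ring] at h2
      have h3 := hX₁ (x - min s 1) (by linarith [ht.2])
      have h4 := h3.1 _ ht
      rw [Real.dist_eq, abs_lt, sub_add_cancel] at h4
      have hpos := h3.2
      set a := F.real (shiftedDelta T x)
      set b := F.real (shiftedDelta T (x - min s 1))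
      set e := F.real (shiftedDelta T (x - s))
      have h5 : d⁻¹ * b ≤ a := (le_div_iff₀ hpos).1 (by linarith [h4.2])
      have h6 : a ≤ (2 - d⁻¹) * b := (div_le_iff₀ hpos).1 (by linarith [h4.1])
      have h7 : b ≤ d * a := by
        have := mul_le_mul_of_nonneg_left h5 hd0.le
        rwa [← mul_assoc, mul_inv_cancel₀ hd0.ne', one_mul] at this
      have h8 : 2 - d⁻¹ ≤ d := by
        have : d * d⁻¹ = 1 := mul_inv_cancel₀ hd0.ne'
        have h9 : 0 < d⁻¹ := inv_pos.2 hd0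
        nlinarith [mul_nonneg h9.le (sq_nonneg (d - 1))]
      have h9 : a ≤ d * b := h6.trans (mul_le_mul_of_nonneg_right h8 hpos.le)
      rw [← hdd, mul_assoc, mul_assoc]
      exact ⟨h2.1.trans (mul_le_mul_of_nonneg_left h7 hd0.le),
        h9.trans (mul_le_mul_of_nonneg_left h2.2 hd0.le)⟩
  obtain ⟨n, hn⟩ := exists_nat_ge K
  filter_upwards [key n (1 + η) (by linarith)] with x hx s hs
  obtain ⟨h1, h2⟩ := hx s ⟨hs.1, hs.2.trans hn⟩
  have h3 := measureReal_nonneg (μ := F) (s := shiftedDelta T x)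
  rw [abs_le]
  constructor <;> nlinarith

/-- Beyond some point, `F (x + Δ)` cannot drop to zero within a bounded distance. -/
lemma exists_le_mul_add (hL : DeltaLongTailed T F) :
    ∃ x₁ : ℝ, (∀ x ≥ x₁, 0 < F.real (shiftedDelta T x)) ∧ ∀ K : ℝ, ∃ C > 0, ∀ x ≥ x₁,
      ∀ s ∈ Icc (0 : ℝ) K, F.real (shiftedDelta T x) ≤ C * F.real (shiftedDelta T (x + s)) := by
  have h1 := (Metric.tendstoUniformlyOn_iff.1 hL.tendsto (1 / 2) (by norm_num)).and
    hL.eventually_pos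
  obtain ⟨x₁, hx₁⟩ := eventually_atTop.1 h1
  refine ⟨x₁, fun x hx => (hx₁ x hx).2, fun K => ?_⟩
  have step : ∀ x ≥ x₁, ∀ t ∈ Icc (0 : ℝ) 1,
      F.real (shiftedDelta T x) ≤ 2 * F.real (shiftedDelta T (x + t)) := by
    intro x hx t ht
    have h := (hx₁ x hx).1 t ht
    rw [Real.dist_eq, abs_lt] at h
    have h3 : 1 / 2 < F.real (shiftedDelta T (x + t)) / F.real (shiftedDelta T x) := by
      linarith [h.2]
    rw [lt_div_iff₀ (hx₁ x hx).2] at h3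
    linarith
  have key : ∀ n : ℕ, ∀ x ≥ x₁, ∀ s ∈ Icc (0 : ℝ) n,
      F.real (shiftedDelta T x) ≤ 2 ^ n * F.real (shiftedDelta T (x + s)) := by
    intro n
    induction n with
    | zero =>
      intro x _ s hs
      obtain rfl : s = 0 := le_antisymm (by simpa using hs.2) hs.1
      simp
    | succ n ih =>
      intro x hx s hs
      push_cast at hs
      have h1 : min s 1 ∈ Icc (0 : ℝ) 1 := ⟨le_min hs.1 zero_le_one, min_le_right _ _⟩
      have h2 : s - min s 1 ∈ Icc (0 : ℝ) n := by
        refine ⟨by linarith [min_le_left s 1], ?_⟩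
        rcases min_choice s 1 with h | h <;> rw [h]
        · simp
        · linarith [hs.2]
      have h3 := step x hx _ h1
      have h4 := ih (x + min s 1) (by linarith [h1.1]) _ h2
      rw [show x + min s 1 + (s - min s 1) = x + s by ring] at h4
      rw [pow_succ]
      linarith
  obtain ⟨n, hn⟩ := exists_nat_ge K
  exact ⟨2 ^ n, by positivity, fun x hx s hs => key n x hx s ⟨hs.1, hs.2.trans hn⟩⟩

end DeltaLongTailed

/-- `ν (x + Δ)` is asymptotically at least `a * F (x + Δ)`. -/
def AsymptoticallyGE (T : EReal) (F ν : Measure ℝ) (a : ℝ) : Prop :=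
  ∀ ε > 0, ∀ᶠ x : ℝ in atTop,
    (a - ε) * F.real (shiftedDelta T x) ≤ ν.real (shiftedDelta T x)

/-- `ν (x + Δ)` is asymptotically at most `b * F (x + Δ)`. -/
def AsymptoticallyLE (T : EReal) (F ν : Measure ℝ) (b : ℝ) : Prop :=
  ∀ ε > 0, ∀ᶠ x : ℝ in atTop,
    ν.real (shiftedDelta T x) ≤ (b + ε) * F.real (shiftedDelta T x)

lemma asymptotically_self (T : EReal) (F : Measure ℝ) :
    AsymptoticallyGE T F F 1 ∧ AsymptoticallyLE T F F 1 := by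
  constructor <;> intro ε hε <;> refine Eventually.of_forall fun x => ?_ <;>
    nlinarith [measureReal_nonneg (μ := F) (s := shiftedDelta T x)]

lemma tendsto_div_iff_asymptotically {T : EReal} {F ν : Measure ℝ} {a : ℝ} (ha : 0 < a)
    (hpos : ∀ᶠ x : ℝ in atTop, 0 < F.real (shiftedDelta T x)) :
    Tendsto (fun x : ℝ => ν.real (shiftedDelta T x) / (a * F.real (shiftedDelta T x)))
      atTop (𝓝 1) ↔ AsymptoticallyGE T F ν a ∧ AsymptoticallyLE T F ν a := by
  rw [Metric.tendsto_nhds]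
  constructor
  · intro h
    constructor <;> intro ε hε <;> filter_upwards [h (ε / a) (by positivity), hpos] with x hx hf <;>
      rw [Real.dist_eq, abs_sub_lt_iff] at hx <;>
      have hd : 0 < a * F.real (shiftedDelta T x) := by positivity
    · have h1 := (le_div_iff₀ hd).1 (sub_lt_comm.1 hx.2).le
      rwa [← mul_assoc, sub_mul, div_mul_cancel₀ _ ha.ne', one_mul] at h1
    · have h1 := (div_le_iff₀ hd).1 (sub_lt_iff_lt_add'.1 hx.1).le
      rwa [← mul_assoc, add_mul, div_mul_cancel₀ _ ha.ne', one_mul] at h1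
  · rintro ⟨h1, h2⟩ ε hε
    filter_upwards [h1 (a * ε / 2) (by positivity), h2 (a * ε / 2) (by positivity), hpos]
      with x hx1 hx2 hf
    have hd : 0 < a * F.real (shiftedDelta T x) := by positivity
    rw [Real.dist_eq, abs_lt]
    constructor
    · have : 1 - ε / 2 ≤ ν.real (shiftedDelta T x) / (a * F.real (shiftedDelta T x)) := by
        rw [le_div_iff₀ hd]; linarith
      linarith
    · have : ν.real (shiftedDelta T x) / (a * F.real (shiftedDelta T x)) ≤ 1 + ε / 2 := by
        rw [div_le_iff₀ hd]; linarith
      linarith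

lemma measureReal_Icc_zero {μ : Measure ℝ} (hμ : μ (Iio 0) = 0) (h : ℝ) :
    μ.real (Icc 0 h) = μ.real (Iic h) := by
  refine measureReal_congr ?_
  have : ∀ᵐ y ∂μ, 0 ≤ y := by
    rw [ae_iff]; simpa [Iio] using hμ
  filter_upwards [this] with y hy
  exact propext ⟨fun h' => h'.2, fun h' => ⟨hy, h'⟩⟩

lemma tendsto_measureReal_Icc_zero {μ : Measure ℝ} [IsFiniteMeasure μ] (hμ : μ (Iio 0) = 0) :
    Tendsto (fun h : ℝ => μ.real (Icc 0 h)) atTop (𝓝 (μ.real univ)) := by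
  simp only [measureReal_Icc_zero hμ]
  exact (ENNReal.tendsto_toReal (measure_ne_top _ _)).comp (tendsto_measure_Iic_atTop μ)

lemma tendsto_measureReal_Ioi {μ : Measure ℝ} [IsFiniteMeasure μ] :
    Tendsto (fun h : ℝ => μ.real (Ioi h)) atTop (𝓝 0) := by
  have h1 : Tendsto (fun h : ℝ => μ.real (Iic h)) atTop (𝓝 (μ.real univ)) :=
    (ENNReal.tendsto_toReal (measure_ne_top _ _)).comp (tendsto_measure_Iic_atTop μ)
  have h2 := h1.const_sub (μ.real univ)
  rw [sub_self] at h2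
  refine h2.congr fun h => ?_
  rw [← compl_Iic, measureReal_compl measurableSet_Iic]

/-- A perturbation `δ` of both an asymptotic constant `a` and the comparison of shifts changes
the product by at most `δ (a + 2)`; it is to be chosen so that the effect stays below `ε`. -/
lemma exists_mul_mul_le {a m ε : ℝ} (ha : 0 ≤ a) (hm : 0 ≤ m) (hε : 0 < ε) :
    ∃ δ > 0, δ ≤ 1 ∧ δ * (a + 2) * m ≤ ε := by
  refine ⟨min 1 (ε / ((a + 2) * (m + 1))), by positivity, min_le_left _ _, ?_⟩
  calc min 1 (ε / ((a + 2) * (m + 1))) * (a + 2) * m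
      ≤ ε / ((a + 2) * (m + 1)) * (a + 2) * m := by gcongr; exact min_le_right _ _
    _ = ε * (m / (m + 1)) := by field_simp
    _ ≤ ε * 1 := by gcongr; rw [div_le_one (by positivity)]; linarith
    _ = ε := mul_one _

section
variable {T : EReal} {F μ ν : Measure ℝ} [IsFiniteMeasure μ] [IsFiniteMeasure ν]

lemma AsymptoticallyGE.jointMass_Icc (hL : DeltaLongTailed T F) {a : ℝ} (ha : 0 ≤ a)
    (hν : AsymptoticallyGE T F ν a) (μ : Measure ℝ) [IsFiniteMeasure μ] (h : ℝ) {ε : ℝ}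
    (hε : 0 < ε) : ∀ᶠ x : ℝ in atTop,
      (a * μ.real (Icc 0 h) - ε) * F.real (shiftedDelta T x) ≤ jointMass T μ ν (Icc 0 h) x := by
  obtain ⟨δ, hδ0, hδ1, hδ⟩ := exists_mul_mul_le ha (measureReal_nonneg (μ := μ) (s := Icc 0 h)) hε
  obtain ⟨X, hX⟩ := eventually_atTop.1 (hν δ hδ0)
  filter_upwards [hL.eventually_abs_sub_le h hδ0, eventually_ge_atTop (X + h)] with x hx hxX
  have hf := measureReal_nonneg (μ := F) (s := shiftedDelta T x)
  refine le_trans ?_ (le_jointMass (c := (a - δ * (a + 2)) * F.real (shiftedDelta T x))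
    measurableSet_Icc fun y hy => ?_)
  · rw [mul_right_comm]
    refine mul_le_mul_of_nonneg_right ?_ hf
    linarith
  · refine le_trans ?_ (hX (x - y) (by linarith [hy.2]))
    have h1 := abs_le.1 (hx y hy)
    have h2 := mul_le_mul_of_nonneg_left h1.1 ha
    have h3 := mul_le_mul_of_nonneg_left h1.2 hδ0.le
    have h4 := mul_le_mul_of_nonneg_right hδ1 (mul_nonneg hδ0.le hf)
    nlinarith

lemma AsymptoticallyLE.jointMass_Icc (hL : DeltaLongTailed T F) {b : ℝ} (hb : 0 ≤ b)
    (hν : AsymptoticallyLE T F ν b) (μ : Measure ℝ) [IsFiniteMeasure μ] (h : ℝ) {ε : ℝ}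
    (hε : 0 < ε) : ∀ᶠ x : ℝ in atTop,
      jointMass T μ ν (Icc 0 h) x ≤ (b * μ.real (Icc 0 h) + ε) * F.real (shiftedDelta T x) := by
  obtain ⟨δ, hδ0, hδ1, hδ⟩ := exists_mul_mul_le hb (measureReal_nonneg (μ := μ) (s := Icc 0 h)) hε
  obtain ⟨X, hX⟩ := eventually_atTop.1 (hν δ hδ0)
  filter_upwards [hL.eventually_abs_sub_le h hδ0, eventually_ge_atTop (X + h)] with x hx hxX
  have hf := measureReal_nonneg (μ := F) (s := shiftedDelta T x)
  refine le_trans (jointMass_le (c := (b + δ * (b + 2)) * F.real (shiftedDelta T x))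
    measurableSet_Icc fun y hy => ?_) ?_
  · refine (hX (x - y) (by linarith [hy.2])).trans ?_
    have h1 := abs_le.1 (hx y hy)
    have h2 := mul_le_mul_of_nonneg_left h1.2 hb
    have h3 := mul_le_mul_of_nonneg_left h1.2 hδ0.le
    have h4 := mul_le_mul_of_nonneg_right hδ1 (mul_nonneg hδ0.le hf)
    nlinarith
  · rw [mul_right_comm]
    refine mul_le_mul_of_nonneg_right ?_ hf
    linarith

/-- The sum of two independent nonnegative variables reaches `x + Δ` when one of them is bounded
and the other makes the jump; these two events are disjoint for large `x`. -/
lemma AsymptoticallyGE.conv (hL : DeltaLongTailed T F) (hμ0 : μ (Iio 0) = 0)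
    (hν0 : ν (Iio 0) = 0) {a b : ℝ} (ha : 0 ≤ a) (hb : 0 ≤ b) (hμ : AsymptoticallyGE T F μ a)
    (hν : AsymptoticallyGE T F ν b) :
    AsymptoticallyGE T F (μ.conv ν) (a * ν.real univ + b * μ.real univ) := by
  intro ε hε
  have h1 := ((tendsto_measureReal_Icc_zero hν0).const_mul a).add
    ((tendsto_measureReal_Icc_zero hμ0).const_mul b)
  obtain ⟨h, hh⟩ := (h1.eventually (lt_mem_nhds (sub_lt_self _ (show 0 < ε / 3 by positivity)))).exists
  filter_upwards [hμ.jointMass_Icc hL ha ν h (show 0 < ε / 3 by positivity),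
    hν.jointMass_Icc hL hb μ h (show 0 < ε / 3 by positivity), eventually_gt_atTop (2 * h)]
    with x hx1 hx2 hx
  have h2 := jointMass_add_le_conv (T := T) (μ := μ) (ν := ν) hx
  have h3 := jointMass_nonneg T μ ν (Ioc h (x - h)) x
  have hf := measureReal_nonneg (μ := F) (s := shiftedDelta T x)
  nlinarith

end

/-! ### Upper bounds under subexponentiality -/

section
variable {T : EReal} {F G : Measure ℝ} [IsProbabilityMeasure F] [IsProbabilityMeasure G]

/-- For a `Δ`-subexponential law, the sum of two variables does not reach `x + Δ` through two
summands that are both large. -/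
lemma eventually_jointMass_Ioc_le (hL : DeltaLongTailed T F) (hF : F (Iio 0) = 0)
    (h2 : AsymptoticallyLE T F (F.conv F) 2) {ε : ℝ} (hε : 0 < ε) :
    ∀ᶠ h : ℝ in atTop, ∀ᶠ x : ℝ in atTop,
      jointMass T F F (Ioc h (x - h)) x ≤ ε * F.real (shiftedDelta T x) := by
  have h1 := tendsto_measureReal_Icc_zero hF
  rw [probReal_univ] at h1
  filter_upwards [h1.eventually (lt_mem_nhds (sub_lt_self _ (show 0 < ε / 8 by positivity)))]
    with h hh
  filter_upwards [(asymptotically_self T F).1.jointMass_Icc hL zero_le_one F h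
    (show 0 < ε / 8 by positivity), h2 (ε / 8) (by positivity), eventually_gt_atTop (2 * h)]
    with x hx1 hx2 hx
  have h3 := jointMass_add_le_conv (T := T) (μ := F) (ν := F) hx
  have hf := measureReal_nonneg (μ := F) (s := shiftedDelta T x)
  nlinarith

/-- The convolution of `F` with itself takes almost half of its mass on `x + Δ` from a second
summand that is small, and at most the rest from a first summand of at most `x - x₀`. The bound
holds for every `x ≥ x₀`, and not only for large `x`, because it has to be iterated. -/
lemma eventually_jointMass_Icc_le (hL : DeltaLongTailed T F) (hF : F (Iio 0) = 0)
    (h2 : AsymptoticallyLE T F (F.conv F) 2) {ε : ℝ} (hε : 0 < ε) :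
    ∀ᶠ x₀ : ℝ in atTop, ∀ x ≥ x₀,
      jointMass T F F (Icc 0 (x - x₀)) x ≤ (1 + ε) * F.real (shiftedDelta T x) := by
  have h1 := tendsto_measureReal_Icc_zero hF
  rw [probReal_univ] at h1
  obtain ⟨h, hh⟩ :=
    (h1.eventually (lt_mem_nhds (sub_lt_self _ (show 0 < ε / 4 by positivity)))).exists
  obtain ⟨X, hX⟩ := eventually_atTop.1 (((asymptotically_self T F).1.jointMass_Icc hL zero_le_one F h
    (show 0 < ε / 4 by positivity)).and (h2 (ε / 4) (by positivity)))
  filter_upwards [eventually_ge_atTop X, eventually_ge_atTop h] with x₀ hx₀ hx₀h x hx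
  obtain ⟨hx1, hx2⟩ := hX x (hx₀.trans hx)
  have h3 := jointMass_Icc_add_le_conv (T := T) (μ := F) (ν := F)
    (show x - x₀ ≤ x - h by linarith)
  have hf := measureReal_nonneg (μ := F) (s := shiftedDelta T x)
  nlinarith

/-- For large `x` this is long-tailedness; on the compact interval that remains, `F (x + Δ)` is
bounded below. -/
lemma eventually_exists_sub_le_mul (hL : DeltaLongTailed T F) :
    ∀ᶠ x₀ : ℝ in atTop, ∃ C > 0, ∀ x ≥ x₀, ∀ s ∈ Icc 0 x₀,
      F.real (shiftedDelta T (x - s)) ≤ C * F.real (shiftedDelta T x) := by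
  obtain ⟨x₁, hpos, hC⟩ := hL.exists_le_mul_add
  filter_upwards [eventually_ge_atTop x₁] with x₀ hx₀
  obtain ⟨X, hX⟩ := eventually_atTop.1 (hL.eventually_abs_sub_le x₀ one_pos)
  obtain ⟨C, hC0, hC⟩ := hC (X - x₁)
  have hf1 := hpos x₁ le_rfl
  refine ⟨max 2 (C / F.real (shiftedDelta T x₁)), by positivity, fun x hx s hs => ?_⟩
  have hf := measureReal_nonneg (μ := F) (s := shiftedDelta T x)
  rcases le_total X x with h | h
  · have h1 := (abs_le.1 (hX x h s hs)).2
    refine le_trans ?_ (mul_le_mul_of_nonneg_right (le_max_left _ _) hf)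
    linarith
  · refine le_trans ?_ (mul_le_mul_of_nonneg_right (le_max_right _ _) hf)
    have h1 := hC x₁ le_rfl (x - x₁) ⟨by linarith, by linarith⟩
    rw [add_sub_cancel] at h1
    refine measureReal_le_one.trans ?_
    rw [div_mul_eq_mul_div, le_div_iff₀ hf1]
    linarith

/-- A Kesten-type bound. On `[x₀, M]` the ratio `G (x + Δ) / F (x + Δ)` has a finite supremum `β`,
and the renewal equation bounds `β` by `1 - m + m ((1 + ε) β + 2 C)` with constants that do not
depend on `M`; as `m (1 + ε) < 1`, this bounds `β` independently of `M`. -/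
lemma exists_forall_le_mul (hL : DeltaLongTailed T F) (hF : F (Iio 0) = 0) (hG : G (Iio 0) = 0)
    (h2 : AsymptoticallyLE T F (F.conv F) 2) {m : ℝ} (hm0 : 0 < m) (hm1 : m < 1)
    (hren : ∀ x, G.real (shiftedDelta T x) = (1 - m) * F.real (shiftedDelta T x)
      + m * (F.conv G).real (shiftedDelta T x)) :
    ∃ x₀ B : ℝ, 0 ≤ B ∧
      ∀ x ≥ x₀, G.real (shiftedDelta T x) ≤ B * F.real (shiftedDelta T x) := by
  obtain ⟨ε, hε, hmε⟩ : ∃ ε > 0, m * (1 + ε) < 1 := by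
    refine ⟨(1 - m) / 2, by linarith, ?_⟩
    nlinarith
  obtain ⟨x₁, hpos, hlow⟩ := hL.exists_le_mul_add
  obtain ⟨x₀, hK, ⟨C, hC0, hC⟩, hx₀1, hx₀0⟩ := ((eventually_jointMass_Icc_le hL hF h2 hε).and
    ((eventually_exists_sub_le_mul hL).and
      ((eventually_ge_atTop x₁).and (eventually_ge_atTop 0)))).exists
  have hD : 0 < 1 - m * (1 + ε) := by linarith
  refine ⟨x₀, ((1 - m) + m * (2 * C)) / (1 - m * (1 + ε)), div_nonneg (by nlinarith) hD.le,
    fun M hM => ?_⟩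
  obtain ⟨c, hc0, hc⟩ := hlow (M - x₁)
  have hf1 := hpos x₁ le_rfl
  set S := (fun x => G.real (shiftedDelta T x) / F.real (shiftedDelta T x)) '' Icc x₀ M with hS
  have hbdd : BddAbove S := by
    refine ⟨c / F.real (shiftedDelta T x₁), ?_⟩
    rintro _ ⟨x, hx, rfl⟩
    have h1 := hc x₁ le_rfl (x - x₁) ⟨by linarith [hx.1], by linarith [hx.2]⟩
    rw [add_sub_cancel] at h1
    have hfx := hpos x (by linarith [hx.1])
    rw [div_le_div_iff₀ hfx hf1]
    have h3 : G.real (shiftedDelta T x) ≤ 1 := measureReal_le_one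
    nlinarith
  have hβ : ∀ x ∈ Icc x₀ M, G.real (shiftedDelta T x) ≤ sSup S * F.real (shiftedDelta T x) :=
    fun x hx => (div_le_iff₀ (hpos x (by linarith [hx.1]))).1 (le_csSup hbdd ⟨x, hx, rfl⟩)
  have hβ0 : 0 ≤ sSup S := by
    refine Real.sSup_nonneg ?_
    rintro _ ⟨x, -, rfl⟩
    positivity
  have hstep : sSup S ≤ (1 - m) + m * ((1 + ε) * sSup S + 2 * C) := by
    refine csSup_le ⟨_, M, ⟨hM, le_rfl⟩, rfl⟩ ?_
    rintro _ ⟨x, hx, rfl⟩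
    have hfx := hpos x (by linarith [hx.1])
    refine (div_le_iff₀ hfx).2 ?_
    have hs1 := conv_le_jointMass_add (T := T) hF hG (x - x₀) x
    have hs2 : jointMass T F G (Icc 0 (x - x₀)) x
        ≤ sSup S * jointMass T F F (Icc 0 (x - x₀)) x :=
      jointMass_le_mul_jointMass measurableSet_Icc fun y hy =>
        hβ (x - y) ⟨by linarith [hy.2], by linarith [hy.1, hx.2]⟩
    have hs3 := mul_le_mul_of_nonneg_left (hK x hx.1) hβ0
    have hs4 := jointMass_Ioi_le (T := T) hF hG x₀ x
    have hs5 : jointMass T G F (Icc 0 x₀) x ≤ C * F.real (shiftedDelta T x) * G.real (Icc 0 x₀) :=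
      jointMass_le measurableSet_Icc fun y hy => hC x hx.1 y hy
    have hs6 : C * F.real (shiftedDelta T x) * G.real (Icc 0 x₀)
        ≤ C * F.real (shiftedDelta T x) * 1 := by gcongr; exact measureReal_le_one
    have hs7 : F.real (shiftedDelta T (x - x₀)) * G.real (Ioi x₀)
        ≤ C * F.real (shiftedDelta T x) * 1 := by
      gcongr
      · exact hC x hx.1 x₀ ⟨hx₀0, le_rfl⟩
      · exact measureReal_le_one
    rw [hren]
    have hs8 : (F.conv G).real (shiftedDelta T x)
        ≤ ((1 + ε) * sSup S + 2 * C) * F.real (shiftedDelta T x) := by linarith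
    have := mul_le_mul_of_nonneg_left hs8 hm0.le
    linarith
  refine (hβ M ⟨hM, le_rfl⟩).trans (mul_le_mul_of_nonneg_right ?_ measureReal_nonneg)
  rw [le_div_iff₀ hD]
  linarith

/-- If `F` is `Δ`-subexponential and `G (x + Δ) = O(F (x + Δ))`, then only one of the summands
of `F ∗ G` makes the jump into `x + Δ`. -/
lemma AsymptoticallyLE.conv (hL : DeltaLongTailed T F) (hF : F (Iio 0) = 0) (hG : G (Iio 0) = 0)
    (h2 : AsymptoticallyLE T F (F.conv F) 2) {x₀ B b : ℝ} (hB0 : 0 ≤ B)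
    (hB : ∀ x ≥ x₀, G.real (shiftedDelta T x) ≤ B * F.real (shiftedDelta T x)) (hb : 0 ≤ b)
    (hGb : AsymptoticallyLE T F G b) : AsymptoticallyLE T F (F.conv G) (b + 1) := by
  intro ε hε
  obtain ⟨h, hmid, hGh, hhx₀, hh0⟩ := ((eventually_jointMass_Ioc_le hL hF h2
    (show 0 < ε / (4 * (B + 1)) by positivity)).and
    ((tendsto_measureReal_Ioi (μ := G).eventually (gt_mem_nhds (show 0 < ε / 8 by positivity))).and
      ((eventually_ge_atTop x₀).and (eventually_ge_atTop 0)))).exists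
  filter_upwards [hmid, hGb.jointMass_Icc hL hb F h (show 0 < ε / 4 by positivity),
    (asymptotically_self T F).2.jointMass_Icc hL zero_le_one G h (show 0 < ε / 4 by positivity),
    hL.eventually_abs_sub_le h one_pos] with x hx1 hx2 hx3 hx4
  have hf := measureReal_nonneg (μ := F) (s := shiftedDelta T x)
  have hs1 := conv_le_jointMass_add (T := T) hF hG (x - h) x
  have hs2 := jointMass_Icc_le_add (T := T) (μ := F) (ν := G) h (x - h) x
  have hs3 : jointMass T F G (Ioc h (x - h)) x ≤ B * jointMass T F F (Ioc h (x - h)) x :=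
    jointMass_le_mul_jointMass measurableSet_Ioc fun y hy => hB (x - y) (by linarith [hy.2])
  have hs4 : B * jointMass T F F (Ioc h (x - h)) x ≤ ε / 4 * F.real (shiftedDelta T x) := by
    refine (mul_le_mul_of_nonneg_left hx1 hB0).trans ?_
    rw [← mul_assoc]
    refine mul_le_mul_of_nonneg_right ?_ hf
    rw [mul_div_assoc', div_le_div_iff₀ (by positivity) (by positivity)]
    nlinarith
  have hs5 := jointMass_Ioi_le (T := T) hF hG h x
  have hs6 : F.real (shiftedDelta T (x - h)) * G.real (Ioi h)
      ≤ (2 * F.real (shiftedDelta T x)) * (ε / 8) := by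
    have := (abs_le.1 (hx4 h ⟨hh0, le_rfl⟩)).2
    gcongr
    linarith
  have hs7 : b * F.real (Icc 0 h) ≤ b * 1 := by gcongr; exact measureReal_le_one
  have hs8 : G.real (Icc 0 h) ≤ 1 := measureReal_le_one
  have hs9 := mul_le_mul_of_nonneg_right hs7 hf
  have hs10 := mul_le_mul_of_nonneg_right hs8 hf
  linarith

end

/-! ### The renewal equation and subexponentiality -/

lemma conv_univ (μ ν : Measure ℝ) [SFinite μ] [SFinite ν] :
    (μ.conv ν) univ = μ univ * ν univ := by
  rw [Measure.conv, Measure.map_apply (by fun_prop) MeasurableSet.univ, preimage_univ,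
    ← univ_prod_univ, Measure.prod_prod]

lemma conv_Iio_zero {μ ν : Measure ℝ} [SFinite μ] [SFinite ν] (hμ : μ (Iio 0) = 0)
    (hν : ν (Iio 0) = 0) :
    (μ.conv ν) (Iio 0) = 0 := by
  rw [Measure.conv, Measure.map_apply (by fun_prop) measurableSet_Iio]
  refine measure_mono_null (t := {p : ℝ × ℝ | p.1 ∈ Iio 0} ∪ {p : ℝ × ℝ | p.2 ∈ Iio 0}) ?_ ?_
  · intro p hp
    by_contra h
    simp only [mem_union, mem_ofPred_eq, mem_Iio, not_or, not_lt, mem_preimage] at h hp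
    linarith [h.1, h.2]
  · refine measure_union_null ?_ ?_
    · exact Measure.quasiMeasurePreserving_fst.preimage_null hμ
    · exact Measure.quasiMeasurePreserving_snd.preimage_null hν

section
variable {T : EReal} {F G : Measure ℝ} [IsProbabilityMeasure F] [IsProbabilityMeasure G] {m : ℝ}

/-- The lower constants that the renewal equation propagates increase to `1 / (1 - m)`. -/
lemma asymptoticallyGE_of_renewal (hL : DeltaLongTailed T F) (hF : F (Iio 0) = 0)
    (hG : G (Iio 0) = 0) (hm0 : 0 < m) (hm1 : m < 1)
    (hren : ∀ x, G.real (shiftedDelta T x) = (1 - m) * F.real (shiftedDelta T x)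
      + m * (F.conv G).real (shiftedDelta T x)) :
    AsymptoticallyGE T F G (1 / (1 - m)) := by
  have hm : 0 < 1 - m := by linarith
  -- One use of the renewal equation turns the lower constant `a` into `1 + m a`.
  have key : ∀ n : ℕ, AsymptoticallyGE T F G ((1 - m ^ n) / (1 - m)) := by
    intro n
    induction n with
    | zero =>
      intro ε hε
      refine Eventually.of_forall fun x => ?_
      have h1 := measureReal_nonneg (μ := F) (s := shiftedDelta T x)
      have h2 := measureReal_nonneg (μ := G) (s := shiftedDelta T x)
      simp only [pow_zero, sub_self, zero_div, zero_sub]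
      nlinarith
    | succ n ih =>
      intro ε hε
      have hpow : m ^ n ≤ 1 := pow_le_one₀ hm0.le hm1.le
      have hc := AsymptoticallyGE.conv hL hF hG zero_le_one (div_nonneg (by linarith) hm.le)
        (asymptotically_self T F).1 ih
      simp only [probReal_univ, mul_one] at hc
      filter_upwards [hc ε hε] with x hx
      rw [hren]
      have h1 := measureReal_nonneg (μ := F) (s := shiftedDelta T x)
      have h2 : (1 - m ^ (n + 1)) / (1 - m) = (1 - m) + m * (1 + (1 - m ^ n) / (1 - m)) := by
        field_simp
        ring
      have h3 := mul_le_mul_of_nonneg_left hx hm0.le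
      rw [h2]
      nlinarith [mul_nonneg (mul_nonneg hm.le hε.le) h1]
  intro ε hε
  have h1 : Tendsto (fun n : ℕ => (1 - m ^ n) / (1 - m)) atTop (𝓝 ((1 - 0) / (1 - m))) :=
    ((tendsto_pow_atTop_nhds_zero_of_lt_one hm0.le hm1).const_sub 1).div_const _
  rw [sub_zero] at h1
  obtain ⟨n, hn⟩ := (h1.eventually (lt_mem_nhds
    (sub_lt_self _ (show 0 < ε / 2 by positivity)))).exists
  filter_upwards [key n (ε / 2) (by positivity)] with x hx
  refine le_trans (mul_le_mul_of_nonneg_right ?_ measureReal_nonneg) hx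
  linarith

/-- The upper constants that the renewal equation propagates decrease to `1 / (1 - m)`; the
Kesten-type bound provides the first one. -/
lemma asymptoticallyLE_of_renewal (hL : DeltaLongTailed T F) (hF : F (Iio 0) = 0)
    (hG : G (Iio 0) = 0) (hm0 : 0 < m) (hm1 : m < 1)
    (hren : ∀ x, G.real (shiftedDelta T x) = (1 - m) * F.real (shiftedDelta T x)
      + m * (F.conv G).real (shiftedDelta T x))
    (h2 : AsymptoticallyLE T F (F.conv F) 2) :
    AsymptoticallyLE T F G (1 / (1 - m)) := by
  have hm : 0 < 1 - m := by linarith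
  obtain ⟨x₀, B, hB0, hB⟩ := exists_forall_le_mul hL hF hG h2 hm0 hm1 hren
  have key : ∀ n : ℕ, AsymptoticallyLE T F G ((1 - m ^ n) / (1 - m) + m ^ n * B) := by
    intro n
    induction n with
    | zero =>
      intro ε hε
      filter_upwards [eventually_ge_atTop x₀] with x hx
      have h1 := measureReal_nonneg (μ := F) (s := shiftedDelta T x)
      have h2 := hB x hx
      simp only [pow_zero, sub_self, zero_div, zero_add, one_mul]
      nlinarith
    | succ n ih =>
      intro ε hε
      have hpow : m ^ n ≤ 1 := pow_le_one₀ hm0.le hm1.le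
      have hc := AsymptoticallyLE.conv hL hF hG h2 hB0 hB
        (add_nonneg (div_nonneg (by linarith) hm.le) (by positivity)) ih
      filter_upwards [hc ε hε] with x hx
      rw [hren]
      have h1 := measureReal_nonneg (μ := F) (s := shiftedDelta T x)
      have h2 : (1 - m ^ (n + 1)) / (1 - m) + m ^ (n + 1) * B
          = (1 - m) + m * ((1 - m ^ n) / (1 - m) + m ^ n * B + 1) := by
        field_simp
        ring
      have h3 := mul_le_mul_of_nonneg_left hx hm0.le
      rw [h2]
      nlinarith [mul_nonneg (mul_nonneg hm.le hε.le) h1]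
  intro ε hε
  have hp := tendsto_pow_atTop_nhds_zero_of_lt_one hm0.le hm1
  have h1 : Tendsto (fun n : ℕ => (1 - m ^ n) / (1 - m) + m ^ n * B) atTop
      (𝓝 ((1 - 0) / (1 - m) + 0 * B)) :=
    ((hp.const_sub 1).div_const _).add (hp.mul_const B)
  rw [sub_zero, zero_mul, add_zero] at h1
  obtain ⟨n, hn⟩ := (h1.eventually (gt_mem_nhds
    (lt_add_of_pos_right _ (show 0 < ε / 2 by positivity)))).exists
  filter_upwards [key n (ε / 2) (by positivity)] with x hx
  refine hx.trans (mul_le_mul_of_nonneg_right ?_ measureReal_nonneg)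
  linarith

/-- Convolving the renewal equation with `F` gives
`F ∗ G = (1 - m) F ∗ F + m F ∗ (F ∗ G)`. The asymptotics of `F ∗ G` are known from those of `G`,
and the lower bound for `F ∗ (F ∗ G)` leaves at most `2 F (x + Δ)` for `F ∗ F`. -/
lemma asymptoticallyLE_conv_self_of_renewal (hL : DeltaLongTailed T F) (hF : F (Iio 0) = 0)
    (hG : G (Iio 0) = 0) (hm0 : 0 < m) (hm1 : m < 1)
    (hren : ∀ x, G.real (shiftedDelta T x) = (1 - m) * F.real (shiftedDelta T x)
      + m * (F.conv G).real (shiftedDelta T x))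
    (hren' : ∀ x, (F.conv G).real (shiftedDelta T x) = (1 - m) * (F.conv F).real (shiftedDelta T x)
      + m * (F.conv (F.conv G)).real (shiftedDelta T x))
    (hGle : AsymptoticallyLE T F G (1 / (1 - m))) :
    AsymptoticallyLE T F (F.conv F) 2 := by
  have hm : 0 < 1 - m := by linarith
  have hge := asymptoticallyGE_of_renewal hL hF hG hm0 hm1 hren
  have hFG := AsymptoticallyGE.conv hL hF hG zero_le_one (by positivity)
    (asymptotically_self T F).1 hge
  have hFG0 := conv_Iio_zero hF hG
  simp only [probReal_univ, mul_one] at hFG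
  have hFFG := AsymptoticallyGE.conv hL hF hFG0 zero_le_one (by positivity)
    (asymptotically_self T F).1 hFG
  simp only [probReal_univ, mul_one] at hFFG
  intro ε hε
  have hη : 0 < m * (1 - m) * ε / 2 := by positivity
  filter_upwards [hGle _ hη, hFFG _ (show 0 < (1 - m) * ε / 2 by positivity)] with x hx1 hx2
  have hf := measureReal_nonneg (μ := F) (s := shiftedDelta T x)
  have h1 := hren x
  have h2 := hren' x
  rw [show 1 / (1 - m) = 1 + m / (1 - m) by field_simp; ring] at hx1 hx2
  set f := F.real (shiftedDelta T x)
  set q := m / (1 - m) with hq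
  have hq' : q * (1 - m) = m := div_mul_cancel₀ _ hm.ne'
  set g := (F.conv G).real (shiftedDelta T x)
  set w := (F.conv (F.conv G)).real (shiftedDelta T x)
  set v := (F.conv F).real (shiftedDelta T x)
  have h3 := mul_le_mul_of_nonneg_left hx2 hm0.le
  -- `m * g ≤ (m + q + m (1 - m) ε / 2) f` and `q = m (1 + q)`
  have h4 : m * g ≤ m * ((2 + q + (1 - m) * ε / 2) * f) := by
    have : q = m * (1 + q) := by linarith
    have h5 : (1 + q + m * (1 - m) * ε / 2) * f - (1 - m) * f
      = m * ((2 + q + (1 - m) * ε / 2) * f) := by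
      linear_combination f * this
    linarith
  have h5 := le_of_mul_le_mul_left h4 hm0
  have h6 : (1 - m) * v ≤ (1 - m) * ((2 + ε) * f) := by
    have h7 : (2 + q + (1 - m) * ε / 2) * f - m * ((1 + (1 + (1 + q)) - (1 - m) * ε / 2) * f)
      = (1 - m) * ((2 + ε) * f) - (1 - m) * (1 - m) * ε / 2 * f := by
      linear_combination f * hq'
    have h8 : 0 ≤ (1 - m) * (1 - m) * ε / 2 * f := by positivity
    linarith
  exact le_of_mul_le_mul_left h6 hm

/-- The analytic core: a probability law `G` with `G = (1 - m) F + m F ∗ G` satisfies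
`G (x + Δ) ∼ F (x + Δ) / (1 - m)` exactly when `F` is `Δ`-subexponential. -/
theorem deltaSubexponential_iff_of_renewal (hL : DeltaLongTailed T F) (hF : F (Iio 0) = 0)
    (hG : G (Iio 0) = 0) (hm0 : 0 < m) (hm1 : m < 1)
    (hren : ∀ x, G.real (shiftedDelta T x) = (1 - m) * F.real (shiftedDelta T x)
      + m * (F.conv G).real (shiftedDelta T x))
    (hren' : ∀ x, (F.conv G).real (shiftedDelta T x) = (1 - m) * (F.conv F).real (shiftedDelta T x)
      + m * (F.conv (F.conv G)).real (shiftedDelta T x)) :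
    DeltaSubexponential T F ↔
      Tendsto (fun x : ℝ => G.real (shiftedDelta T x) / (F.real (shiftedDelta T x) / (1 - m)))
        atTop (𝓝 1) := by
  have hm : 0 < 1 - m := by linarith
  have hrw : (fun x : ℝ => G.real (shiftedDelta T x) / (F.real (shiftedDelta T x) / (1 - m)))
      = fun x : ℝ => G.real (shiftedDelta T x) / (1 / (1 - m) * F.real (shiftedDelta T x)) := by
    funext x; rw [one_div_mul_eq_div]
  rw [hrw, tendsto_div_iff_asymptotically (by positivity) hL.eventually_pos]
  constructor
  · intro hS
    have h2 := ((tendsto_div_iff_asymptotically two_pos hL.eventually_pos).1 hS.conv_tendsto).2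
    exact ⟨asymptoticallyGE_of_renewal hL hF hG hm0 hm1 hren,
      asymptoticallyLE_of_renewal hL hF hG hm0 hm1 hren h2⟩
  · rintro ⟨-, hle⟩
    refine ⟨hF, fun x => ?_, hL,
      (tendsto_div_iff_asymptotically two_pos hL.eventually_pos).2 ⟨?_, ?_⟩⟩
    · obtain ⟨y, hy, hxy⟩ := (hL.eventually_pos.and (eventually_ge_atTop x)).exists
      have h1 : 0 < F (shiftedDelta T y) := (ENNReal.toReal_pos_iff.1 hy).1
      exact h1.trans_le (measure_mono fun z hz => hxy.trans_lt hz.1)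
    · have := AsymptoticallyGE.conv hL hF hF zero_le_one zero_le_one
        (asymptotically_self T F).1 (asymptotically_self T F).1
      simp only [probReal_univ, mul_one] at this
      convert this using 1
      norm_num
    · exact asymptoticallyLE_conv_self_of_renewal hL hF hG hm0 hm1 hren hren' hle

end

/-! ### The genealogy of the branching process -/

/-- A list is empty or has a head and a tail. -/
def listEquivSum : Unit ⊕ (ℕ × List ℕ) ≃ List ℕ where
  toFun := Sum.elim (fun _ => []) fun a => a.1 :: a.2
  invFun
    | [] => Sum.inl ()
    | i :: u => Sum.inr (i, u)
  left_inv a := by rcases a with _ | a <;> rfl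
  right_inv u := by cases u <;> rfl

lemma tsum_list_eq (f : List ℕ → ℝ≥0∞) :
    ∑' u, f u = f [] + ∑' i, ∑' u, f (i :: u) := by
  rw [← listEquivSum.tsum_eq, Summable.tsum_sum ENNReal.summable ENNReal.summable,
    ← ENNReal.tsum_prod]
  simp [listEquivSum]

lemma tsum_toMeasure_Ioi (p : PMF ℕ) : ∑' i : ℕ, p.toMeasure (Ioi i) = offspringMean p := by
  simp only [PMF.toMeasure_apply _ measurableSet_Ioi]
  rw [ENNReal.tsum_comm, offspringMean]
  congr with k
  have h : ∀ i : ℕ, (Ioi i).indicator p k = (Iio k).indicator (fun _ => p k) i := fun i => by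
    simp [indicator_apply]
  simp only [h]
  rw [← tsum_subtype, ENNReal.tsum_const]
  simp

/-- The weight of a list is the product of the weights `q i` of its entries; the lists of length
`n` have total weight `(∑ q i) ^ n`. -/
lemma tsum_list_eq_geometric (q : ℕ → ℝ≥0∞) (w : List ℕ → ℝ≥0∞) (h0 : w [] = 1)
    (h1 : ∀ i u, w (i :: u) = q i * w u) : ∑' u, w u = (1 - ∑' i, q i)⁻¹ := by
  have key : ∀ n : ℕ, ∑' u : List ℕ, (if u.length = n then w u else 0) = (∑' i, q i) ^ n := by
    intro n
    induction n with
    | zero => rw [tsum_list_eq]; simp [h0]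
    | succ n ih =>
      rw [tsum_list_eq]
      have h2 : ∀ i u, (if (i :: u).length = n + 1 then w (i :: u) else 0)
          = q i * (if u.length = n then w u else 0) := fun i u => by simp [h1]
      simp only [h2, ENNReal.tsum_mul_left, ENNReal.tsum_mul_right, ih]
      simp [pow_succ']
  rw [← ENNReal.tsum_geometric]
  simp only [← key]
  rw [ENNReal.tsum_comm]
  simp

section
variable {Ω : Type*} {L : List ℕ → Ω → ℝ} {N : List ℕ → Ω → ℕ}

/-- The event that the particle `u` is ever born. -/
def bornEvent (N : List ℕ → Ω → ℕ) (u : List ℕ) : Set Ω := {ω | everBorn (fun v => N v ω) u}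

/-- The information carried by the particles of the first `n` generations. -/
@[reducible] def pastGenerations (L : List ℕ → Ω → ℝ) (N : List ℕ → Ω → ℕ) (n : ℕ) : MeasurableSpace Ω :=
  ⨆ v ∈ {v : List ℕ | v.length < n},
    MeasurableSpace.comap (fun ω => (L v ω, N v ω)) inferInstance

lemma comap_le_pastGenerations {v : List ℕ} {n : ℕ} (h : v.length < n) :
    MeasurableSpace.comap (fun ω => (L v ω, N v ω)) inferInstance ≤ pastGenerations L N n :=
  le_iSup₂_of_le (f := fun (v : List ℕ) (_ : v ∈ {v : List ℕ | v.length < n}) =>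
    MeasurableSpace.comap (fun ω => (L v ω, N v ω)) inferInstance) v h le_rfl

lemma pastGenerations_mono : Monotone (pastGenerations L N) := fun _ _ h =>
  iSup₂_le fun _ hv => comap_le_pastGenerations (lt_of_lt_of_le hv h)

lemma measurable_past_mark {v : List ℕ} {n : ℕ} (h : v.length < n) :
    Measurable[pastGenerations L N n] fun ω => (L v ω, N v ω) :=
  (comap_measurable _).mono (comap_le_pastGenerations h) le_rfl

lemma measurable_birthTime (u : List ℕ) :
    Measurable[pastGenerations L N u.length] fun ω => birthTime (fun v => L v ω) u := by
  induction u with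
  | nil => exact measurable_const
  | cons i u ih =>
    have h1 := ih.mono (pastGenerations_mono (Nat.le_succ _)) le_rfl
    have h2 := measurable_fst.comp (measurable_past_mark (L := L) (N := N) (Nat.lt_succ_self u.length))
    exact h1.add h2

lemma measurableSet_bornEvent (u : List ℕ) :
    MeasurableSet[pastGenerations L N u.length] (bornEvent N u) := by
  induction u with
  | nil => exact MeasurableSet.univ
  | cons i u ih =>
    have h1 := pastGenerations_mono (L := L) (N := N) (Nat.le_succ u.length) _ ih
    have h2 := measurable_snd.comp (measurable_past_mark (L := L) (N := N) (Nat.lt_succ_self u.length))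
    exact h1.inter (h2 (measurableSet_Ioi (a := i)))

end

section
variable {Ω : Type*} [MeasurableSpace Ω] {P : Measure Ω} {F : Measure ℝ} {p : PMF ℕ}
  {L : List ℕ → Ω → ℝ} {N : List ℕ → Ω → ℕ}

lemma pastGenerations_le (hm : ∀ u, Measurable fun ω => (L u ω, N u ω)) (n : ℕ) :
    pastGenerations L N n ≤ ‹MeasurableSpace Ω› :=
  iSup₂_le fun v _ => (hm v).comap_le

lemma IsBellmanHarris.indep_pastGenerations (hZ : IsBellmanHarris P F p L N)
    (hm : ∀ u, Measurable fun ω => (L u ω, N u ω)) (u : List ℕ) :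
    Indep (pastGenerations L N u.length)
      (MeasurableSpace.comap (fun ω => (L u ω, N u ω)) inferInstance) P := by
  have h := indep_iSup_of_disjoint (fun v => (hm v).comap_le)
    ((iIndepFun_iff_iIndep _ _ _).1 hZ.indep)
    (S := {v : List ℕ | v.length < u.length}) (T := {u}) (by simp)
  simpa [pastGenerations] using h

/-- The law of the birth time of the particle `u`, restricted to the event that `u` is born. -/
noncomputable def birthLaw (P : Measure Ω) (L : List ℕ → Ω → ℝ) (N : List ℕ → Ω → ℕ)
    (u : List ℕ) : Measure ℝ :=
  (P.restrict (bornEvent N u)).map fun ω => birthTime (fun v => L v ω) u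

instance [IsFiniteMeasure P] (u : List ℕ) : IsFiniteMeasure (birthLaw P L N u) := by
  unfold birthLaw; infer_instance

namespace IsBellmanHarris
variable [IsProbabilityMeasure P] [IsProbabilityMeasure F]

/-- The lifetime and the offspring number of a particle are independent of its birth. -/
lemma map_birthTime_mark (hZ : IsBellmanHarris P F p L N)
    (hm : ∀ u, Measurable fun ω => (L u ω, N u ω)) (u : List ℕ) :
    (P.restrict (bornEvent N u)).map
        (fun ω => (birthTime (fun v => L v ω) u, (L u ω, N u ω)))
      = (birthLaw P L N u).prod (F.prod p.toMeasure) := by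
  have hb := (measurable_birthTime (L := L) (N := N) u).mono (pastGenerations_le hm _) le_rfl
  have hB := pastGenerations_le hm _ _ (measurableSet_bornEvent (L := L) (N := N) u)
  symm
  refine Measure.prod_eq fun A C hA hC => ?_
  rw [Measure.map_apply (hb.prodMk (hm u)) (hA.prod hC), birthLaw, Measure.map_apply hb hA,
    Measure.restrict_apply (hb.prodMk (hm u) (hA.prod hC)), Measure.restrict_apply (hb hA),
    ← (hZ.hasLaw u).map_eq, Measure.map_apply (hm u) hC]
  rw [← (Indep_iff _ _ _).1 (hZ.indep_pastGenerations hm u) _ _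
    ((measurable_birthTime u hA).inter (measurableSet_bornEvent u)) ⟨C, hC, rfl⟩]
  congr 1
  ext ω
  simp only [mem_inter_iff, mem_preimage, mem_prod]
  tauto

lemma map_deathTime_offspring (hZ : IsBellmanHarris P F p L N)
    (hm : ∀ u, Measurable fun ω => (L u ω, N u ω)) (u : List ℕ) :
    (P.restrict (bornEvent N u)).map
        (fun ω => (birthTime (fun v => L v ω) u + L u ω, N u ω))
      = ((birthLaw P L N u).conv F).prod p.toMeasure := by
  have hb := (measurable_birthTime (L := L) (N := N) u).mono (pastGenerations_le hm _) le_rfl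
  have h1 : Measurable fun q : ℝ × ℝ × ℕ => (q.1 + q.2.1, q.2.2) := by fun_prop
  have h2 := congrArg (Measure.map fun q : ℝ × ℝ × ℕ => (q.1 + q.2.1, q.2.2))
    (hZ.map_birthTime_mark hm u)
  rw [Measure.map_map h1 (hb.prodMk (hm u)),
    ← (measurePreserving_prodAssoc _ F p.toMeasure).map_eq,
    Measure.map_map h1 MeasurableEquiv.prodAssoc.measurable] at h2
  refine h2.trans ?_
  have h3 := Measure.map_prod_map ((birthLaw P L N u).prod F) p.toMeasure
    (f := fun x : ℝ × ℝ => x.1 + x.2) (g := id) (by fun_prop) measurable_id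
  rw [Measure.map_id] at h3
  exact h3.symm

lemma birthLaw_nil : birthLaw P L N [] = Measure.dirac 0 := by
  simp [birthLaw, bornEvent, everBorn, birthTime]

/-- The child `i` of `u` is born at the death of `u`, provided that `u` has more than `i`
children. -/
lemma birthLaw_cons (hZ : IsBellmanHarris P F p L N)
    (hm : ∀ u, Measurable fun ω => (L u ω, N u ω)) (i : ℕ) (u : List ℕ) :
    birthLaw P L N (i :: u) = p.toMeasure (Ioi i) • (birthLaw P L N u).conv F := by
  have hb : ∀ u, Measurable fun ω => birthTime (fun v => L v ω) u := fun u =>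
    (measurable_birthTime (L := L) (N := N) u).mono (pastGenerations_le hm _) le_rfl
  have hd : Measurable fun ω => (birthTime (fun v => L v ω) u + L u ω, N u ω) :=
    ((hb u).add (measurable_fst.comp (hm u))).prodMk (measurable_snd.comp (hm u))
  ext A hA
  have h1 := congrArg (fun ν => ν (A ×ˢ Ioi i)) (hZ.map_deathTime_offspring hm u)
  simp only [Measure.prod_prod] at h1
  rw [Measure.map_apply hd (hA.prod measurableSet_Ioi),
    Measure.restrict_apply (hd (hA.prod measurableSet_Ioi))] at h1
  rw [Measure.smul_apply, smul_eq_mul, mul_comm, ← h1, birthLaw, Measure.map_apply (hb _) hA,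
    Measure.restrict_apply (hb _ hA)]
  congr 1
  ext ω
  simp only [bornEvent, everBorn, birthTime, mem_inter_iff, mem_preimage, mem_prod, mem_Ioi,
    mem_ofPred_eq]
  tauto

lemma birthLaw_Iio_zero (hZ : IsBellmanHarris P F p L N) (hF : F (Iio 0) = 0)
    (hm : ∀ u, Measurable fun ω => (L u ω, N u ω)) (u : List ℕ) :
    birthLaw P L N u (Iio 0) = 0 := by
  induction u with
  | nil => simp [birthLaw_nil]
  | cons i u ih => rw [hZ.birthLaw_cons hm, Measure.smul_apply, conv_Iio_zero ih hF, smul_zero]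

/-- A particle born by time `t` is either alive at time `t` or dead by then. -/
lemma measure_alive_add (hZ : IsBellmanHarris P F p L N) (hF : F (Iio 0) = 0)
    (hm : ∀ u, Measurable fun ω => (L u ω, N u ω)) (t : ℝ) (u : List ℕ) :
    P {ω | u ∈ aliveAt (fun v => L v ω) (fun v => N v ω) t}
      + ((birthLaw P L N u).conv F) (Iic t) = birthLaw P L N u (Iic t) := by
  have hb := (measurable_birthTime (L := L) (N := N) u).mono (pastGenerations_le hm _) le_rfl
  have hB := pastGenerations_le hm _ _ (measurableSet_bornEvent (L := L) (N := N) u)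
  have hd : Measurable fun ω => (birthTime (fun v => L v ω) u + L u ω, N u ω) :=
    (hb.add (measurable_fst.comp (hm u))).prodMk (measurable_snd.comp (hm u))
  have h1 := congrArg (fun ν => ν (Iic t ×ˢ univ)) (hZ.map_deathTime_offspring hm u)
  simp only [Measure.prod_prod, measure_univ, mul_one] at h1
  have hdm := hd (measurableSet_Iic (a := t) |>.prod MeasurableSet.univ)
  rw [Measure.map_apply hd (measurableSet_Iic.prod MeasurableSet.univ),
    Measure.restrict_apply hdm] at h1
  rw [← h1, birthLaw, Measure.map_apply hb measurableSet_Iic,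
    Measure.restrict_apply (hb measurableSet_Iic), ← measure_union _ (hdm.inter hB)]
  · have hL : ∀ᵐ ω ∂P, 0 ≤ L u ω := by
      have h2 : (F.prod p.toMeasure) (Prod.fst ⁻¹' Iio 0) = 0 :=
        Measure.quasiMeasurePreserving_fst.preimage_null hF
      rw [← (hZ.hasLaw u).map_eq,
        Measure.map_apply (hm u) (measurable_fst measurableSet_Iio)] at h2
      rw [ae_iff]
      simpa [preimage] using h2
    refine measure_congr ?_
    filter_upwards [hL] with ω hω
    refine propext ?_
    change (everBorn (fun v => N v ω) u ∧ (birthTime (fun v => L v ω) u : EReal) ≤ t ∧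
        (t : EReal) < ((birthTime (fun v => L v ω) u + L u ω : ℝ) : EReal)) ∨
      ((birthTime (fun v => L v ω) u + L u ω ≤ t ∧ True) ∧ everBorn (fun v => N v ω) u) ↔
      (birthTime (fun v => L v ω) u ≤ t ∧ everBorn (fun v => N v ω) u)
    rw [EReal.coe_le_coe_iff, EReal.coe_lt_coe_iff]
    constructor
    · rintro (⟨h1, h2, -⟩ | ⟨⟨h1, -⟩, h2⟩)
      · exact ⟨h2, h1⟩
      · exact ⟨by linarith, h2⟩
    · rintro ⟨h1, h2⟩
      rcases lt_or_ge t (birthTime (fun v => L v ω) u + L u ω) with h3 | h3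
      · exact Or.inl ⟨h2, h1, h3⟩
      · exact Or.inr ⟨⟨h3, trivial⟩, h2⟩
  · rw [Set.disjoint_left]
    rintro ω ⟨-, -, h2⟩ ⟨h3, -⟩
    exact absurd h3.1 (not_le.2 (EReal.coe_lt_coe_iff.1 h2))

end IsBellmanHarris
end

/-! ### The mean population size -/

lemma population_eq_tsum {Ω : Type*} (L : List ℕ → Ω → ℝ) (N : List ℕ → Ω → ℕ) (s : EReal)
    (ω : Ω) : population L N s ω
      = ∑' u, {ω | u ∈ aliveAt (fun v => L v ω) (fun v => N v ω) s}.indicator 1 ω := by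
  rw [population, ← ENNReal.tsum_set_one, tsum_subtype _ (fun _ => (1 : ℝ≥0∞))]
  rfl

section
variable {Ω : Type*} [MeasurableSpace Ω] {P : Measure Ω} {F : Measure ℝ} {p : PMF ℕ} {L : List ℕ → Ω → ℝ} {N : List ℕ → Ω → ℕ}

/-- The expected number of births in a set of times. -/
noncomputable def birthMeasure (P : Measure Ω) (L : List ℕ → Ω → ℝ) (N : List ℕ → Ω → ℕ) :
    Measure ℝ :=
  Measure.sum fun u => birthLaw P L N u

lemma birthMeasure_conv (F : Measure ℝ) [SFinite F] :
    (birthMeasure P L N).conv F = Measure.sum fun u => (birthLaw P L N u).conv F := by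
  unfold birthMeasure Measure.conv
  rw [Measure.prod_sum_left, Measure.map_sum (by fun_prop)]

lemma meanPopulation_top : meanPopulation P L N ⊤ = 0 := by
  simp [meanPopulation, population, aliveAt]

namespace IsBellmanHarris

/-- The lifetimes and offspring numbers may be changed on null sets to become measurable. -/
lemma exists_measurable (hZ : IsBellmanHarris P F p L N) :
    ∃ (L' : List ℕ → Ω → ℝ) (N' : List ℕ → Ω → ℕ), IsBellmanHarris P F p L' N' ∧
      (∀ u, Measurable fun ω => (L' u ω, N' u ω)) ∧
      ∀ s, meanPopulation P L N s = meanPopulation P L' N' s := by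
  have ha := fun u => (hZ.hasLaw u).aemeasurable
  have he := fun u => (ha u).ae_eq_mk
  refine ⟨fun u ω => ((ha u).mk _ ω).1, fun u ω => ((ha u).mk _ ω).2,
    ⟨fun u => ?_, hZ.indep.congr he⟩, fun u => (ha u).measurable_mk, fun s => ?_⟩
  · exact (hZ.hasLaw u).congr (he u).symm
  · refine lintegral_congr_ae ?_
    filter_upwards [ae_all_iff.2 he] with ω hω
    have h1 : ∀ u, L u ω = ((ha u).mk _ ω).1 := fun u => congrArg Prod.fst (hω u)
    have h2 : ∀ u, N u ω = ((ha u).mk _ ω).2 := fun u => congrArg Prod.snd (hω u)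
    simp only [population, h1, h2]

variable [IsProbabilityMeasure P] [IsProbabilityMeasure F]

lemma birthMeasure_univ (hZ : IsBellmanHarris P F p L N)
    (hm : ∀ u, Measurable fun ω => (L u ω, N u ω)) :
    birthMeasure P L N univ = (1 - offspringMean p)⁻¹ := by
  rw [birthMeasure, Measure.sum_apply _ MeasurableSet.univ, ← tsum_toMeasure_Ioi]
  refine tsum_list_eq_geometric _ _ (by simp [birthLaw_nil]) fun i u => ?_
  rw [hZ.birthLaw_cons hm, Measure.smul_apply, smul_eq_mul, conv_univ,
    measure_univ (μ := F), mul_one]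

/-- Every birth but the first one happens at the death of a parent. -/
lemma birthMeasure_eq (hZ : IsBellmanHarris P F p L N)
    (hm : ∀ u, Measurable fun ω => (L u ω, N u ω)) :
    birthMeasure P L N
      = Measure.dirac 0 + offspringMean p • (birthMeasure P L N).conv F := by
  ext A hA
  rw [birthMeasure_conv, birthMeasure, Measure.add_apply, Measure.smul_apply,
    Measure.sum_apply _ hA, Measure.sum_apply _ hA, tsum_list_eq, birthLaw_nil,
    ← tsum_toMeasure_Ioi, smul_eq_mul, ← ENNReal.tsum_mul_right]
  simp only [hZ.birthLaw_cons hm, Measure.smul_apply, smul_eq_mul, ENNReal.tsum_mul_left]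

lemma measurableSet_alive (hm : ∀ u, Measurable fun ω => (L u ω, N u ω)) (t : ℝ) (u : List ℕ) :
    MeasurableSet {ω | u ∈ aliveAt (fun v => L v ω) (fun v => N v ω) t} := by
  have hb := (measurable_birthTime (L := L) (N := N) u).mono (pastGenerations_le hm _) le_rfl
  have hB := pastGenerations_le hm _ _ (measurableSet_bornEvent (L := L) (N := N) u)
  have hd := hb.add (measurable_fst.comp (hm u))
  convert hB.inter ((hb measurableSet_Iic).inter (hd (measurableSet_Ioi (a := t)))) using 1
  · ext ω
    simp only [aliveAt, EReal.coe_le_coe_iff, EReal.coe_lt_coe_iff]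
    rfl

/-- Births up to time `t` are the particles alive at time `t` and the deaths up to time `t`. -/
lemma meanPopulation_add (hZ : IsBellmanHarris P F p L N) (hF : F (Iio 0) = 0)
    (hm : ∀ u, Measurable fun ω => (L u ω, N u ω)) (t : ℝ) :
    meanPopulation P L N t + ((birthMeasure P L N).conv F) (Iic t)
      = birthMeasure P L N (Iic t) := by
  have h1 : meanPopulation P L N t
      = ∑' u, P {ω | u ∈ aliveAt (fun v => L v ω) (fun v => N v ω) t} := by
    simp only [meanPopulation, population_eq_tsum]
    rw [lintegral_tsum fun u => (measurable_one.indicator (measurableSet_alive hm t u)).aemeasurable]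
    exact tsum_congr fun u => lintegral_indicator_one (measurableSet_alive hm t u)
  rw [h1, birthMeasure_conv, birthMeasure, Measure.sum_apply _ measurableSet_Iic,
    Measure.sum_apply _ measurableSet_Iic, ← ENNReal.tsum_add]
  exact tsum_congr fun u => hZ.measure_alive_add hF hm t u

/-- The mean population size is finite, and it is the tail of a probability law `G` with
`G = (1 - m) F + m F ∗ G`, where `m` is the mean number of children: `G` is the law of the sum of a
geometric number of lifetimes. -/
lemma exists_renewal (hZ : IsBellmanHarris P F p L N) (hF : F (Iio 0) = 0)
    (hp1 : offspringMean p < 1) :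
    (∀ t : ℝ, meanPopulation P L N t < ⊤) ∧
    ∃ G : Measure ℝ, IsProbabilityMeasure G ∧ G (Iio 0) = 0 ∧
      G = (1 - offspringMean p) • F + offspringMean p • F.conv G ∧
      ∀ t : ℝ, 0 ≤ t → (meanPopulation P L N t).toReal = G.real (Ioi t) := by
  obtain ⟨L', N', hZ', hm, hA⟩ := hZ.exists_measurable
  simp only [hA]
  set m := offspringMean p
  set M := birthMeasure P L' N' with hM
  have hm' : 1 - m ≠ 0 := (tsub_pos_of_lt hp1).ne'
  have hmt : 1 - m ≠ ⊤ := ENNReal.sub_ne_top ENNReal.one_ne_top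
  have hMu : M univ = (1 - m)⁻¹ := hZ'.birthMeasure_univ hm
  have hMf : IsFiniteMeasure M := ⟨by rw [hMu]; exact ENNReal.inv_lt_top.2 (tsub_pos_of_lt hp1)⟩
  have hM0 : M (Iio 0) = 0 := by
    rw [hM, birthMeasure, Measure.sum_apply _ measurableSet_Iio, ENNReal.tsum_eq_zero]
    exact hZ'.birthLaw_Iio_zero hF hm
  have hMe : M = Measure.dirac 0 + m • M.conv F := hZ'.birthMeasure_eq hm
  have hadd := hZ'.meanPopulation_add hF hm
  have hG1 : IsProbabilityMeasure ((1 - m) • M.conv F) := by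
    constructor
    rw [Measure.smul_apply, smul_eq_mul, conv_univ, measure_univ (μ := F), mul_one, hMu,
      ENNReal.mul_inv_cancel hm' hmt]
  refine ⟨fun t => ?_, (1 - m) • M.conv F, hG1, ?_, ?_, fun t ht => ?_⟩
  · exact (le_self_add.trans_eq (hadd t)).trans_lt (measure_lt_top M _)
  · rw [Measure.smul_apply, conv_Iio_zero hM0 hF, smul_zero]
  · have h1 : M.conv F = F + m • F.conv (M.conv F) := by
      conv_lhs => rw [hMe]
      rw [Measure.add_conv, Measure.dirac_zero_conv, Measure.conv_smul_left,
        Measure.conv_comm (M.conv F) F]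
    have h2 : F.conv ((1 - m) • M.conv F) = (1 - m) • F.conv (M.conv F) := by
      rw [Measure.conv_comm F ((1 - m) • M.conv F), Measure.conv_smul_left,
        Measure.conv_comm (M.conv F) F]
    conv_lhs => rw [h1]
    rw [h2, smul_add, smul_comm]
  · have h1 := hadd t
    have h2 : M (Iic t) = 1 + m * (M.conv F) (Iic t) := by
      conv_lhs => rw [hMe]
      simp [ht]
    rw [← hM, h2] at h1
    have h3 := congrArg ENNReal.toReal h1
    have hfin : meanPopulation P L' N' t ≠ ⊤ :=
      ((le_self_add.trans_eq (hadd t)).trans_lt (measure_lt_top M _)).ne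
    have hmf : m ≠ ⊤ := (hp1.trans ENNReal.one_lt_top).ne
    rw [ENNReal.toReal_add hfin (measure_ne_top _ _), ENNReal.toReal_add ENNReal.one_ne_top
      (ENNReal.mul_ne_top hmf (measure_ne_top _ _)), ENNReal.toReal_mul] at h3
    rw [← compl_Iic, probReal_compl_eq_one_sub measurableSet_Iic, measureReal_ennreal_smul_apply,
      ENNReal.toReal_sub_of_le hp1.le ENNReal.one_ne_top]
    simp only [ENNReal.toReal_one, Measure.real] at h3 ⊢
    linarith

end IsBellmanHarris
end

theorem mainTheorem8 {Ω : Type*} [MeasurableSpace Ω] (P : Measure Ω) [IsProbabilityMeasure P]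
    (T : EReal) (hT : 0 < T)
    (F : Measure ℝ) [IsProbabilityMeasure F] (hF : F (Iio 0) = 0)
    (p : PMF ℕ) (hp0 : 0 < offspringMean p) (hp1 : offspringMean p < 1)
    (L : List ℕ → Ω → ℝ) (N : List ℕ → Ω → ℕ) (hZ : IsBellmanHarris P F p L N)
    (hL : DeltaLongTailed T F) :
    (∀ t : ℝ, meanPopulation P L N (t : EReal) < ⊤) ∧
    (DeltaSubexponential T F ↔
      Tendsto
        (fun t : ℝ =>
          ((meanPopulation P L N (t : EReal)).toReal
              - (meanPopulation P L N ((t : EReal) + T)).toReal)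
            / (F.real (shiftedDelta T t) / (1 - (offspringMean p).toReal)))
        atTop (𝓝 1)) := by
  obtain ⟨hfin, G, hG, hG0, hren, htail⟩ := hZ.exists_renewal hF hp1
  refine ⟨hfin, ?_⟩
  have hmt : offspringMean p ≠ ⊤ := (hp1.trans ENNReal.one_lt_top).ne
  have h1m : (1 - offspringMean p).toReal = 1 - (offspringMean p).toReal := by
    rw [ENNReal.toReal_sub_of_le hp1.le ENNReal.one_ne_top, ENNReal.toReal_one]
  have hconv : F.conv G
      = (1 - offspringMean p) • F.conv F + offspringMean p • F.conv (F.conv G) := by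
    have hsf : SFinite ((1 - offspringMean p) • F) := inferInstance
    rw [Measure.conv_comm F G]
    conv_lhs => rw [hren]
    rw [Measure.add_conv, Measure.conv_smul_left, Measure.conv_smul_left,
      Measure.conv_comm (F.conv G) F, Measure.conv_comm G F]
  have hreal : ∀ (a b : ℝ≥0∞) (μ ν : Measure ℝ) [IsFiniteMeasure μ] [IsFiniteMeasure ν] (A : Set ℝ),
      a ≠ ⊤ → b ≠ ⊤ → (a • μ + b • ν).real A = a.toReal * μ.real A + b.toReal * ν.real A := by
    intro a b μ ν _ _ A ha hb
    simp only [Measure.real, Measure.add_apply, Measure.smul_apply, smul_eq_mul]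
    rw [ENNReal.toReal_add (ENNReal.mul_ne_top ha (measure_ne_top _ _))
      (ENNReal.mul_ne_top hb (measure_ne_top _ _)), ENNReal.toReal_mul, ENNReal.toReal_mul]
  have hct : 1 - offspringMean p ≠ ⊤ := ENNReal.sub_ne_top ENNReal.one_ne_top
  rw [deltaSubexponential_iff_of_renewal (G := G) (m := (offspringMean p).toReal) hL hF hG0
    (ENNReal.toReal_pos hp0.ne' hmt)
    (by rw [← ENNReal.toReal_one]; exact (ENNReal.toReal_lt_toReal hmt ENNReal.one_ne_top).2 hp1)
    (fun x => by
      conv_lhs => rw [hren]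
      rw [hreal _ _ _ _ _ hct hmt, h1m])
    (fun x => by
      conv_lhs => rw [hconv]
      rw [hreal _ _ _ _ _ hct hmt, h1m])]
  refine tendsto_congr' ?_
  filter_upwards [eventually_ge_atTop 0] with t ht
  congr 1
  rw [htail t ht]
  induction T with
  | bot => simp at hT
  | top => rw [EReal.coe_add_top, meanPopulation_top, shiftedDelta_top]; simp
  | coe r =>
    have hr : 0 < r := by exact_mod_cast hT
    rw [← EReal.coe_add, htail _ (by linarith), shiftedDelta_coe, ← Ioi_sdiff_Ioi,
      measureReal_sdiff (Ioi_subset_Ioi (by linarith)) measurableSet_Ioi]
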